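/- Write $\lg x = \lfloor \log_2 x \rfloor + 1$ for integers $x \ge 1$, $|w|$ for the length of a word $w$, and let $\Sigma$ be a finite alphabet. **Shrinking cellular automata.** A shrinking cellular automaton (SCA) has a finite state set $Q \supsetneq \Sigma$, a local transition function $\delta\colon Q^3 \to Q$, an inactive state $q \in Q \setminus \Sigma$ with $\delta(q_1,q,q_2) = q$ for all $q_1,q_2 \in Q$, a delete state $\otimes \in Q \setminus (\Sigma \cup \{q\})$, and a set $A \subseteq Q \setminus \{q\}$ of accepting states. Its initial configuration for $w \in \Sigma^+$ is the map $c_0\colon \mathbb{Z} \to Q$ that carries $w$ in the cells $0, \dots, |w|-1$ and $q$ elsewhere. A step replaces $c$ by $i \mapsto \delta(c(i-1), c(i), c(i+1))$ and then removes all cells in state $\otimes$, contracting the cells $0, 1, 2, \dots$ and the cells $-1, -2, \dots$ separately towards cell zero. A word $w \in \Sigma^+$ is accepted in step $\tau \ge 0$ if cell zero is in an accepting state after $\tau$ steps. For $t\colon \mathbb{N}_+ \to \mathbb{N}_+$, $\mathrm{SCA}[t]$ is the class of languages $L \subseteq \Sigma^+$ for which there are an SCA that accepts exactly the words of $L$ and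 a constant $c$ such that every $w \in L$ is accepted in some step $\tau \le c \cdot t(|w|)$. **Streaming algorithms.** A streaming algorithm is a random access machine (finite program, registers holding natural numbers, initially $0$) that reads its input $w$ once from left to right, symbol by symbol, and has read-only access to the binary digits of $|w|$. Operations are counted as operations on single bits (logarithmic cost: an instruction that handles numbers and addresses of $\ell$ bits in total counts as $\ell+1$ operations). The machine has space $s$ if on every $w \in \Sigma^+$ it always uses only the first $s(|w|)$ registers, which hold at most $s(|w|)$ bits in total. It has update time $u$ if on every $w \in \Sigma^+$ it performs at most $u(|w|)$ operations before reading the first symbol and, whenever some but not all symbols have been read, at most $u(|w|)$ operations until it reads the next symbol or terminates. It has reporting time $r$ if it performs at most $r(|w|)$ operations after having read the last symbol. It is a streaming algorithm for $L$ if on every $w \in \Sigma^+$ it terminates with the correct answer to $w \in L$. **Theorem 2.** Let $t\colon \mathbb{N}_+ \to \mathbb{N}_+$ be such that $n \mapsto t(n)$ is computable by a random access machine as above (with read-only access to the binary digits of $n$ and no input stream) in $O(t(n))$ space and $O(t(n) \lg t(n))$ time. Then, if $L \in \mathrm{SCA}[t]$, there is a streaming algorithm for $L$ that has $O(t(n))$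 space, $O(t(n) \lg t(n))$ update time and $O(t(n)^2 \lg t(n))$ reporting time. -/

import Mathlib

/-! ## Cellular automata and shrinking cellular automata -/

/-- A (bounded) cellular automaton with the standard neighbourhood.  The input alphabet `α` is a
subset of the set of states through the injection `inp`. -/
structure CellAut (α : Type) where
  /-- the set of states -/
  Q : Type
  [finite_Q : Finite Q]
  /-- the local transition function: left neighbour, cell, right neighbour -/
  δ : Q → Q → Q → Q
  /-- the inclusion of the input alphabet -/
  inp : α ↪ Q
  /-- the inactive state -/
  q : Q
  /-- the accepting states -/
  acc : Set Q
  inp_ne_q : ∀ a, inp a ≠ q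
  δ_q : ∀ x y, δ x q y = q
  q_not_acc : q ∉ acc

namespace CellAut

variable {α : Type} (C : CellAut α)

/-- The global transition function of a cellular automaton. -/
def globalStep (c : ℤ → C.Q) : ℤ → C.Q :=
  fun i => C.δ (c (i - 1)) (c i) (c (i + 1))

/-- The initial configuration: `w` in the cells `0, …, |w| - 1`, all other cells inactive. -/
def initCfg (w : List α) : ℤ → C.Q
  | Int.ofNat i => (w[i]?).elim C.q C.inp
  | Int.negSucc _ => C.q

end CellAut

/-- Remove all occurrences of the letter `d` from an `ω`-word: the `i`-th letter of the result is
the `i`-th letter of `f` that differs from `d`.  (This is meaningful when infinitely many letters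
differ from `d`, which is the case for all configurations arising from finite inputs.) -/
noncomputable def eraseHalf {Q : Type} (d : Q) (f : ℕ → Q) : ℕ → Q :=
  fun i => f (Nat.nth (fun k => f k ≠ d) i)

/-- Remove all cells in state `d` from a bi-infinite configuration, by contracting the two halves
`c 0, c 1, …` and `c (-1), c (-2), …` separately towards cell zero. -/
noncomputable def eraseCells {Q : Type} (d : Q) (c : ℤ → Q) : ℤ → Q
  | Int.ofNat i => eraseHalf d (fun k => c (Int.ofNat k)) i
  | Int.negSucc i => eraseHalf d (fun k => c (Int.negSucc k)) i

/-- A shrinking cellular automaton: a cellular automaton with a delete state. -/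
structure ShrinkingCA (α : Type) extends CellAut α where
  /-- the delete state -/
  del : Q
  del_ne_q : del ≠ q
  inp_ne_del : ∀ a, inp a ≠ del

namespace ShrinkingCA

variable {α : Type} (S : ShrinkingCA α)

/-- The global transition function of a shrinking CA: a step of the underlying CA, followed by
the removal of all cells that are in the delete state. -/
noncomputable def shrinkStep (c : ℤ → S.Q) : ℤ → S.Q :=
  eraseCells S.del (S.globalStep c)

/-- The configuration reached from input `w` after `τ` steps. -/
noncomputable def cfgAt (w : List α) (τ : ℕ) : ℤ → S.Q :=
  S.shrinkStep^[τ] (S.initCfg w)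

/-- Cell zero is in an accepting state after `τ` steps on input `w`. -/
def AcceptsAt (w : List α) (τ : ℕ) : Prop :=
  S.cfgAt w τ 0 ∈ S.acc

/-- The set of all (non-empty) words accepted by `S`. -/
def language : Language α :=
  {w | w ≠ [] ∧ ∃ τ, S.AcceptsAt w τ}

/-- `S` has time complexity `T`: every accepted word `w` is accepted within `T |w|` steps. -/
def HasTime (T : ℕ → ℕ) : Prop :=
  ∀ w ∈ S.language, ∃ τ ≤ T w.length, S.AcceptsAt w τ

end ShrinkingCA

/-- `L ∈ SCA[t]`: some shrinking CA accepts exactly `L`, with time complexity `O(t)`. -/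
def InSCA {α : Type} (t : ℕ → ℕ) (L : Language α) : Prop :=
  ∃ S : ShrinkingCA α, S.language = L ∧ ∃ c : ℕ, S.HasTime (fun n => c * t n)

/-! ## Random access machines with a one-pass input stream

The registers `R 0, R 1, R 2, …` hold natural numbers in binary.  Besides its registers, a machine
has a one-way read-only input stream over a finite alphabet, and read-only access to the binary
digits of a number `n`, the length of the input.  Costs are bit costs (logarithmic cost criterion):
an instruction that handles numbers and addresses of `ℓ` bits in total counts as `ℓ + 1` operations
on single bits. -/

/-- The instructions of a random access machine with program labels in `Λ`.  The register numbers
and numerals which are written in an instruction are constants of the program; an address that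
is computed is the content of a register. -/
inductive RAMInstr (α Λ : Type) : Type
  /-- `R i := k` -/
  | const (i k : ℕ) (next : Λ)
  /-- `R i := R j + R k` -/
  | add (i j k : ℕ) (next : Λ)
  /-- `R i := R j - R k` (and `0` if this is negative) -/
  | sub (i j k : ℕ) (next : Λ)
  /-- `R i := ⌊R j / 2⌋` -/
  | half (i j : ℕ) (next : Λ)
  /-- `R i := R (R j)` -/
  | load (i j : ℕ) (next : Λ)
  /-- `R (R i) := R j` -/
  | store (i j : ℕ) (next : Λ)
  /-- unconditional jump -/
  | jump (next : Λ)
  /-- conditional jump on `R j = 0` -/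
  | ifZero (j : ℕ) (yes no : Λ)
  /-- jump depending on the binary digit number `R j` of the input length (digit `0` is the least
  significant one), `none` meaning that there are not that many digits -/
  | lenDigit (j : ℕ) (next : Option Bool → Λ)
  /-- read the next input symbol and jump depending on it, `none` meaning that all the symbols
  have already been read -/
  | read (next : Option α → Λ)
  /-- stop; the output is the content of `R 0` -/
  | halt

/-- A random access machine: a finite program. -/
structure RAM (α : Type) where
  /-- the program labels -/
  Label : Type
  [finite_Label : Finite Label]
  /-- the label at which the computation starts -/
  start : Label
  /-- the instruction at each label -/
  code : Label → RAMInstr α Label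

/-- A configuration: current label, contents of the registers, number of input symbols read. -/
structure RAMCfg (Λ : Type) where
  /-- the current label -/
  label : Λ
  /-- the contents of the registers -/
  reg : ℕ → ℕ
  /-- the number of input symbols read so far -/
  pos : ℕ

/-- The registers fit into space `s`: only the registers `0, …, s - 1` are in use, and they hold
at most `s` bits in total. -/
def FitsIn (s : ℕ) (reg : ℕ → ℕ) : Prop :=
  (∀ a, s ≤ a → reg a = 0) ∧ ∑ a ∈ Finset.range s, Nat.size (reg a) ≤ s

namespace RAM

variable {α : Type} (M : RAM α)

/-- All registers are empty and no input symbol has been read. -/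
def initCfg : RAMCfg M.Label := ⟨M.start, fun _ => 0, 0⟩

/-- One instruction, with the number `n` as the available length and `w` as the input stream. -/
def step (n : ℕ) (w : List α) (c : RAMCfg M.Label) : RAMCfg M.Label :=
  let R := c.reg
  match M.code c.label with
  | .const i k next => ⟨next, Function.update R i k, c.pos⟩
  | .add i j k next => ⟨next, Function.update R i (R j + R k), c.pos⟩
  | .sub i j k next => ⟨next, Function.update R i (R j - R k), c.pos⟩
  | .half i j next => ⟨next, Function.update R i (R j / 2), c.pos⟩
  | .load i j next => ⟨next, Function.update R i (R (R j)), c.pos⟩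
  | .store i j next => ⟨next, Function.update R (R i) (R j), c.pos⟩
  | .jump next => ⟨next, R, c.pos⟩
  | .ifZero j yes no => ⟨if R j = 0 then yes else no, R, c.pos⟩
  | .lenDigit j next =>
      ⟨next (if R j < Nat.size n then some (n.testBit (R j)) else none), R, c.pos⟩
  | .read next =>
      match w[c.pos]? with
      | some a => ⟨next (some a), R, c.pos + 1⟩
      | none => ⟨next none, R, c.pos⟩
  | .halt => c

/-- The number of bit operations of the next instruction (none, once the machine has halted). -/
def cost (c : RAMCfg M.Label) : ℕ :=
  let R := c.reg
  match M.code c.label with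
  | .const _ k _ => 1 + Nat.size k
  | .add _ j k _ => 1 + Nat.size (R j) + Nat.size (R k)
  | .sub _ j k _ => 1 + Nat.size (R j) + Nat.size (R k)
  | .half _ j _ => 1 + Nat.size (R j)
  | .load _ j _ => 1 + Nat.size (R j) + Nat.size (R (R j))
  | .store i j _ => 1 + Nat.size (R i) + Nat.size (R j)
  | .jump _ => 1
  | .ifZero j _ _ => 1 + Nat.size (R j)
  | .lenDigit j _ => 1 + Nat.size (R j)
  | .read _ => 1
  | .halt => 0

/-- The configuration after `k` instructions. -/
def run (n : ℕ) (w : List α) (k : ℕ) : RAMCfg M.Label :=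
  (M.step n w)^[k] M.initCfg

/-- The machine eventually halts with output `v`. -/
def HaltsWith (n : ℕ) (w : List α) (v : ℕ) : Prop :=
  ∃ k, M.code (M.run n w k).label = .halt ∧ (M.run n w k).reg 0 = v

/-- The number of bit operations during the first `k` instructions. -/
def totalOps (n : ℕ) (w : List α) (k : ℕ) : ℕ :=
  ∑ m ∈ Finset.range k, M.cost (M.run n w m)

/-- The number of bit operations which are performed, among the first `k` instructions, while
exactly `i` symbols of the input have been read (including the reading of the next one). -/
def opsAtPos (n : ℕ) (w : List α) (k i : ℕ) : ℕ :=
  ∑ m ∈ Finset.range k with (M.run n w m).pos = i, M.cost (M.run n w m)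

/-! ### Streaming algorithms -/

/-- As a streaming algorithm (which has access to the length of its input), `M` decides `L`: on
every non-empty word it halts, with output `1` if the word belongs to `L` and `0` otherwise. -/
def Decides (L : Language α) : Prop :=
  ∀ w : List α, w ≠ [] →
    (w ∈ L → M.HaltsWith w.length w 1) ∧ (w ∉ L → M.HaltsWith w.length w 0)

/-- On every non-empty input `w`, the machine always stays within space `s |w|`. -/
def HasSpace (s : ℕ → ℕ) : Prop :=
  ∀ w : List α, w ≠ [] → ∀ k, FitsIn (s w.length) (M.run w.length w k).reg

/-- On every non-empty input `w`, at most `u |w|` operations are performed before the first symbol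
is read, and at most `u |w|` between the reading of a symbol that is not the last one and the
reading of the next one (or termination, if this comes first). -/
def HasUpdateTime (u : ℕ → ℕ) : Prop :=
  ∀ w : List α, w ≠ [] → ∀ i < w.length, ∀ k, M.opsAtPos w.length w k i ≤ u w.length

/-- On every non-empty input `w`, at most `r |w|` operations are performed after the last symbol
has been read. -/
def HasReportingTime (r : ℕ → ℕ) : Prop :=
  ∀ w : List α, w ≠ [] → ∀ k, M.opsAtPos w.length w k w.length ≤ r w.length

end RAM

/-- `f` is computable on the positive integers by a random access machine in space `O(s)` and time
`O(T)`, the argument being available through its binary digits (and nothing on the stream). -/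
def RAMComputable (f s T : ℕ → ℕ) : Prop :=
  ∃ (M : RAM Empty) (c : ℕ), ∀ n, 0 < n →
    M.HaltsWith n [] (f n) ∧
    (∀ k, FitsIn (c * s n) (M.run n [] k).reg) ∧
    (∀ k, M.totalOps n [] k ≤ c * T n)

/-- The number of binary digits of a positive integer: the logarithm in resource bounds, which
must not vanish at `1`. -/
def lg (x : ℕ) : ℕ := Nat.log 2 x + 1

/-!
Write `f_τ` for the cells `0, 1, …` of the shrinking automaton after `τ` steps; the cells to the
left of cell zero are always inactive. A letter of `f_(τ+1)` depends on three consecutive letters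
of `f_τ`, and deletion only drops letters, so a prefix of `f_τ` determines a prefix of `f_(τ+1)`,
and to extend the latter when one more letter of `f_τ` arrives it is enough to remember the last
two letters of `f_τ` (`ShrinkingCA.succWord_cons`, `ShrinkingCA.succWord_revPrefix`). Hence all
the configurations `0, …, N - 1` can be computed simultaneously, in a streaming fashion, with two
letters of memory for each. Since inactive cells are neither changed nor deleted, feeding `N`
inactive letters after the input makes at least one letter reach each of the configurations, which
reveals its cell zero (`ShrinkingCA.accWord_iff`). If accepted words are accepted within `k * t n`
steps, then `N = 2 ^ k * t n` configurations decide membership.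

The machine `ShrinkingCA.streamRAM` first computes `t n` with the given machine and then carries
this out, one register per configuration. Processing a letter takes `O(N)` instructions on numbers
of `O(lg N)` bits, whence the update time `O(t n * lg (t n))`; the `N` final inactive letters cost
`N` times as much. Its run is verified backwards from the end: `RAM.Good` says that a
configuration leads to a correct halt within given space and time budgets, there is one rule for
each kind of instruction, and `ShrinkingCA.good_initCfg` puts the whole run together.
-/

/-! ### Words received by successive configurations -/

/-- The first `m` letters of an `ω`-word, the latest one first. -/
def revPrefix {β : Type} (f : ℕ → β) : ℕ → List β
  | 0 => []
  | m + 1 => f m :: revPrefix f m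

theorem getLast?_revPrefix {β : Type} (f : ℕ → β) (m : ℕ) :
    (revPrefix f (m + 1)).getLast? = some (f 0) := by
  induction m with
  | zero => rfl
  | succ m ih => rw [revPrefix, revPrefix, List.getLast?_cons_cons]; exact ih

theorem revPrefix_add_of_eq {β : Type} (f : ℕ → β) (b : β) (n j : ℕ)
    (h : ∀ i, n ≤ i → f i = b) :
    revPrefix f (n + j) = List.replicate j b ++ revPrefix f n := by
  induction j with
  | zero => rfl
  | succ j ih => simp [revPrefix, ih, List.replicate_succ, h]

namespace ShrinkingCA

variable {α : Type} (S : ShrinkingCA α)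

open Classical in
/-- If a configuration has so far delivered the letters of `u` in its cells `0, 1, …` (latest
letter first, the cells left of cell zero being inactive), then `S.succWord u` lists the cells
`0, 1, …` of the successor configuration that are determined by `u`, again the latest one first. -/
noncomputable def succWord : List S.Q → List S.Q
  | [] => []
  | [_] => []
  | z :: y :: r =>
    if S.δ (r.headD S.q) y z = S.del then succWord (y :: r)
    else S.δ (r.headD S.q) y z :: succWord (y :: r)

/-- Among `p` successive configurations, the first of which has delivered `u`, one is known to have
an accepting cell zero. -/
def AccWord (p : ℕ) (u : List S.Q) : Prop :=
  ∃ j < p, ∃ a ∈ (S.succWord^[j] u).getLast?, a ∈ S.acc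

theorem succWord_iterate_nil (j : ℕ) : S.succWord^[j] [] = [] := by
  induction j with
  | zero => rfl
  | succ j ih => rw [Function.iterate_succ_apply]; exact ih

theorem not_accWord_nil (p : ℕ) : ¬ S.AccWord p [] := by
  rintro ⟨j, _, a, ha, _⟩
  simp [succWord_iterate_nil] at ha

theorem not_accWord_zero (u : List S.Q) : ¬ S.AccWord 0 u := by
  rintro ⟨j, hj, _⟩
  omega

theorem accWord_succ (p : ℕ) (u : List S.Q) :
    S.AccWord (p + 1) u ↔ (∃ a ∈ u.getLast?, a ∈ S.acc) ∨ S.AccWord p (S.succWord u) := by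
  constructor
  · rintro ⟨j, hj, h⟩
    cases j with
    | zero => exact Or.inl h
    | succ j => exact Or.inr ⟨j, by omega, h⟩
  · rintro (h | ⟨j, hj, h⟩)
    · exact ⟨0, by omega, h⟩
    · exact ⟨j + 1, by omega, h⟩

theorem succWord_replicate (j : ℕ) (v : List S.Q) :
    ∃ v', S.succWord (List.replicate (j + 1) S.q ++ v) = List.replicate j S.q ++ v' := by
  induction j with
  | zero => exact ⟨_, rfl⟩
  | succ j ih =>
    obtain ⟨v', hv'⟩ := ih
    refine ⟨v', ?_⟩
    rw [List.replicate_succ, List.cons_append] at hv'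
    rw [List.replicate_succ, List.replicate_succ, List.cons_append, List.cons_append, succWord,
      S.δ_q, if_neg S.del_ne_q.symm, hv', List.cons_append]

/-- Each inactive letter at the end of the input reaches one configuration further than the
previous one. -/
theorem succWord_iterate_replicate (τ j : ℕ) (v : List S.Q) :
    ∃ v', S.succWord^[τ] (List.replicate (τ + j) S.q ++ v) = List.replicate j S.q ++ v' := by
  induction τ generalizing v with
  | zero => exact ⟨v, by simp⟩
  | succ τ ih =>
    obtain ⟨v', hv'⟩ := S.succWord_replicate (τ + j) v
    obtain ⟨v'', hv''⟩ := ih v'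
    refine ⟨v'', ?_⟩
    rw [Function.iterate_succ_apply, show τ + 1 + j = τ + j + 1 by omega, hv', hv'']

theorem cfgAt_negSucc (w : List α) (τ i : ℕ) : S.cfgAt w τ (Int.negSucc i) = S.q := by
  induction τ generalizing i with
  | zero => rfl
  | succ τ ih =>
    rw [cfgAt, Function.iterate_succ_apply']
    change S.δ _ (S.cfgAt w τ (Int.negSucc _)) _ = S.q
    rw [ih, S.δ_q]

/-- The cells `0, 1, …` of the configuration after `τ` steps. -/
noncomputable def rightHalf (w : List α) (τ i : ℕ) : S.Q := S.cfgAt w τ (Int.ofNat i)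

theorem succWord_revPrefix (w : List α) (τ m : ℕ) :
    ∃ m', S.succWord (revPrefix (S.rightHalf w τ) m) = revPrefix (S.rightHalf w (τ + 1)) m' := by
  classical
  set g : ℕ → S.Q := fun k => S.globalStep (S.cfgAt w τ) (Int.ofNat k) with hg
  have hE : S.rightHalf w (τ + 1) = eraseHalf S.del g := by
    funext i
    rw [rightHalf, cfgAt, Function.iterate_succ_apply']
    rfl
  suffices h : ∀ m, S.succWord (revPrefix (S.rightHalf w τ) (m + 1)) =
      revPrefix (S.rightHalf w (τ + 1)) (Nat.count (fun k => g k ≠ S.del) m) by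
    cases m with
    | zero => exact ⟨0, rfl⟩
    | succ m => exact ⟨_, h m⟩
  intro m
  induction m with
  | zero => simp [revPrefix, succWord]
  | succ m ih =>
    have hgm : S.δ ((revPrefix (S.rightHalf w τ) m).headD S.q) (S.rightHalf w τ m)
        (S.rightHalf w τ (m + 1)) = g m := by
      have : (revPrefix (S.rightHalf w τ) m).headD S.q = S.cfgAt w τ (Int.ofNat m - 1) := by
        cases m with
        | zero => exact (S.cfgAt_negSucc w τ 0).symm
        | succ m => simp [revPrefix, rightHalf]
      rw [this]
      rfl
    rw [revPrefix, revPrefix, succWord, hgm, ← revPrefix, ih, Nat.count_succ]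
    by_cases h : g m = S.del
    · simp [h]
    · rw [if_neg h, if_pos h, revPrefix, hE]
      congr 1
      rw [eraseHalf, Nat.nth_count (p := fun k => g k ≠ S.del) h]

theorem succWord_iterate_revPrefix (w : List α) (τ m : ℕ) :
    ∃ m', S.succWord^[τ] (revPrefix (S.rightHalf w 0) m) = revPrefix (S.rightHalf w τ) m' := by
  induction τ with
  | zero => exact ⟨m, rfl⟩
  | succ τ ih =>
    obtain ⟨m', hm'⟩ := ih
    rw [Function.iterate_succ_apply', hm']
    exact S.succWord_revPrefix w τ m'

theorem rightHalf_zero_of_lt (w : List α) (i : ℕ) (h : i < w.length) :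
    S.rightHalf w 0 i = S.inp w[i] := by
  simp [rightHalf, cfgAt, CellAut.initCfg, h]

theorem rightHalf_zero_of_le (w : List α) (i : ℕ) (h : w.length ≤ i) :
    S.rightHalf w 0 i = S.q := by
  simp [rightHalf, cfgAt, CellAut.initCfg, h]

/-- Once `N` inactive letters have been delivered after the input word, cell zero is known in the
configurations `0, …, N - 1`. -/
theorem accWord_iff (w : List α) (N : ℕ) :
    S.AccWord N (revPrefix (S.rightHalf w 0) (w.length + N)) ↔ ∃ τ < N, S.AcceptsAt w τ := by
  refine exists_congr fun τ => and_congr_right fun hτ => ?_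
  obtain ⟨m', hm'⟩ := S.succWord_iterate_revPrefix w τ (w.length + N)
  obtain ⟨v, hv⟩ := S.succWord_iterate_replicate τ (N - τ) (revPrefix (S.rightHalf w 0) w.length)
  have hne : m' ≠ 0 := by
    rintro rfl
    rw [revPrefix_add_of_eq _ S.q _ _ (S.rightHalf_zero_of_le w),
      show N = τ + (N - τ) by omega, hv, show N - τ = (N - τ - 1) + 1 by omega] at hm'
    simp [revPrefix, List.replicate_succ] at hm'
  obtain ⟨m, rfl⟩ := Nat.exists_eq_succ_of_ne_zero hne
  rw [hm', getLast?_revPrefix]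
  simp only [Option.mem_def, Option.some.injEq, exists_eq_left', AcceptsAt]
  rfl

end ShrinkingCA

/-- On a non-empty word `w`, membership in the language of a shrinking CA of time complexity `T`
is decided by any number of configurations exceeding `T |w|`. -/
theorem ShrinkingCA.HasTime.mem_language_iff {α : Type} {S : ShrinkingCA α} {T : ℕ → ℕ}
    (hT : S.HasTime T) (w : List α) (hw : w ≠ []) (N : ℕ) (hN : T w.length < N) :
    w ∈ S.language ↔ S.AccWord N (revPrefix (S.rightHalf w 0) (w.length + N)) := by
  rw [S.accWord_iff]
  constructor
  · intro h
    obtain ⟨τ, hτ, h⟩ := hT w h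
    exact ⟨τ, by omega, h⟩
  · rintro ⟨τ, _, h⟩
    exact ⟨hw, τ, h⟩

/-! ### Budgeted runs of random access machines -/

namespace RAM

variable {α : Type} (M : RAM α)

/-- The run of `M` from `c` halts with output `v`, stays within space `s`, and performs at most
`b` operations until the next symbol is read, and at most `U i` operations at each later position
`i` of the input. -/
inductive Good (n : ℕ) (w : List α) (s : ℕ) (U : ℕ → ℕ) (v : ℕ) : RAMCfg M.Label → ℕ → Prop
  | halt (c : RAMCfg M.Label) (b : ℕ) : M.code c.label = .halt → FitsIn s c.reg → c.reg 0 = v →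
      Good n w s U v c b
  | step (c : RAMCfg M.Label) (b : ℕ) : (M.step n w c).pos = c.pos → FitsIn s c.reg →
      Good n w s U v (M.step n w c) b → Good n w s U v c (M.cost c + b)
  | read (c : RAMCfg M.Label) (b : ℕ) : (M.step n w c).pos = c.pos + 1 → FitsIn s c.reg →
      Good n w s U v (M.step n w c) (U (c.pos + 1)) → Good n w s U v c (M.cost c + b)

variable {M} {n : ℕ} {w : List α} {s : ℕ} {U : ℕ → ℕ} {v : ℕ}

theorem Good.mono {c : RAMCfg M.Label} {b b' : ℕ} (h : M.Good n w s U v c b) (hb : b ≤ b') :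
    M.Good n w s U v c b' := by
  induction h generalizing b' with
  | halt c b h1 h2 h3 => exact .halt c b' h1 h2 h3
  | step c b h1 h2 _ ih =>
    obtain ⟨d, rfl⟩ := Nat.exists_eq_add_of_le hb
    rw [add_assoc]
    exact .step c _ h1 h2 (ih (by omega))
  | read c b h1 h2 h3 _ =>
    obtain ⟨d, rfl⟩ := Nat.exists_eq_add_of_le hb
    rw [add_assoc]
    exact .read c _ h1 h2 h3

theorem step_of_halt {c : RAMCfg M.Label} (h : M.code c.label = .halt) : M.step n w c = c := by
  simp [RAM.step, h]

theorem iterate_step_of_halt {c : RAMCfg M.Label} (h : M.code c.label = .halt) (k : ℕ) :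
    (M.step n w)^[k] c = c :=
  Function.iterate_fixed (step_of_halt h) k

theorem Good.halts {c : RAMCfg M.Label} {b : ℕ} (h : M.Good n w s U v c b) :
    ∃ k, M.code ((M.step n w)^[k] c).label = .halt ∧ ((M.step n w)^[k] c).reg 0 = v := by
  induction h with
  | halt c b h1 h2 h3 => exact ⟨0, h1, h3⟩
  | step c b _ _ _ ih | read c b _ _ _ ih =>
    obtain ⟨k, hk⟩ := ih
    exact ⟨k + 1, hk⟩

theorem Good.fitsIn {c : RAMCfg M.Label} {b : ℕ} (h : M.Good n w s U v c b) (k : ℕ) :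
    FitsIn s ((M.step n w)^[k] c).reg := by
  induction h generalizing k with
  | halt c b h1 h2 h3 => rwa [iterate_step_of_halt h1]
  | step c b _ h2 _ ih | read c b _ h2 _ ih =>
    cases k with
    | zero => exact h2
    | succ k => exact ih k

variable (M n w) in
/-- The number of operations at position `i` during `k` steps from `c`. -/
def opsFrom (c : RAMCfg M.Label) (i k : ℕ) : ℕ :=
  ∑ m ∈ Finset.range k with ((M.step n w)^[m] c).pos = i, M.cost ((M.step n w)^[m] c)

theorem opsFrom_succ (c : RAMCfg M.Label) (i k : ℕ) :
    M.opsFrom n w c i (k + 1) =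
      M.opsFrom n w (M.step n w c) i k + if c.pos = i then M.cost c else 0 := by
  simp only [opsFrom, Finset.sum_filter, Finset.sum_range_succ']
  rfl

theorem opsFrom_of_halt {c : RAMCfg M.Label} (h : M.code c.label = .halt) (i k : ℕ) :
    M.opsFrom n w c i k = 0 := by
  have : M.cost c = 0 := by simp [RAM.cost, h]
  simp [opsFrom, iterate_step_of_halt h, this]

theorem Good.opsFrom_le {c : RAMCfg M.Label} {b : ℕ} (h : M.Good n w s U v c b) (i k : ℕ) :
    M.opsFrom n w c i k ≤ if i < c.pos then 0 else if i = c.pos then b else U i := by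
  induction h generalizing k with
  | halt c b h1 _ _ => simp [opsFrom_of_halt h1]
  | step c b h1 _ _ ih =>
    cases k with
    | zero => simp [opsFrom]
    | succ k =>
      have := ih k
      rw [h1] at this
      rw [opsFrom_succ]
      split_ifs at this ⊢ <;> omega
  | read c b h1 _ _ ih =>
    cases k with
    | zero => simp [opsFrom]
    | succ k =>
      have := ih k
      rw [h1] at this
      rw [opsFrom_succ]
      by_cases hi : i = c.pos + 1
      · subst hi
        simpa using this
      · split_ifs at this ⊢ <;> omega

/-! ### Rules for the single instructions

All numbers that are handled are at most `V`, so that an instruction costs at most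
`1 + 2 * Nat.size V`. -/

section Rules

variable {V : ℕ} {l : M.Label} {R : ℕ → ℕ} {pos b : ℕ}

theorem Good.const {i k : ℕ} {l' : M.Label} (hl : M.code l = .const i k l') (hR : FitsIn s R)
    (hk : k ≤ V) (h : M.Good n w s U v ⟨l', Function.update R i k, pos⟩ b) :
    M.Good n w s U v ⟨l, R, pos⟩ (b + (1 + 2 * V.size)) := by
  have h1 := Nat.size_le_size hk
  refine Good.mono (.step ⟨l, R, pos⟩ b ?_ hR ?_) ?_
  · simp [RAM.step, hl]
  · simpa [RAM.step, hl] using h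
  · simp [RAM.cost, hl]; omega

theorem Good.add {i j k : ℕ} {l' : M.Label} (hl : M.code l = .add i j k l') (hR : FitsIn s R)
    (hj : R j ≤ V) (hk : R k ≤ V)
    (h : M.Good n w s U v ⟨l', Function.update R i (R j + R k), pos⟩ b) :
    M.Good n w s U v ⟨l, R, pos⟩ (b + (1 + 2 * V.size)) := by
  have h1 := Nat.size_le_size hj
  have h2 := Nat.size_le_size hk
  refine Good.mono (.step ⟨l, R, pos⟩ b ?_ hR ?_) ?_
  · simp [RAM.step, hl]
  · simpa [RAM.step, hl] using h
  · simp [RAM.cost, hl]; omega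

theorem Good.sub {i j k : ℕ} {l' : M.Label} (hl : M.code l = .sub i j k l') (hR : FitsIn s R)
    (hj : R j ≤ V) (hk : R k ≤ V)
    (h : M.Good n w s U v ⟨l', Function.update R i (R j - R k), pos⟩ b) :
    M.Good n w s U v ⟨l, R, pos⟩ (b + (1 + 2 * V.size)) := by
  have h1 := Nat.size_le_size hj
  have h2 := Nat.size_le_size hk
  refine Good.mono (.step ⟨l, R, pos⟩ b ?_ hR ?_) ?_
  · simp [RAM.step, hl]
  · simpa [RAM.step, hl] using h
  · simp [RAM.cost, hl]; omega

theorem Good.load {i j : ℕ} {l' : M.Label} (hl : M.code l = .load i j l') (hR : FitsIn s R)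
    (hj : R j ≤ V) (hk : R (R j) ≤ V)
    (h : M.Good n w s U v ⟨l', Function.update R i (R (R j)), pos⟩ b) :
    M.Good n w s U v ⟨l, R, pos⟩ (b + (1 + 2 * V.size)) := by
  have h1 := Nat.size_le_size hj
  have h2 := Nat.size_le_size hk
  refine Good.mono (.step ⟨l, R, pos⟩ b ?_ hR ?_) ?_
  · simp [RAM.step, hl]
  · simpa [RAM.step, hl] using h
  · simp [RAM.cost, hl]; omega

theorem Good.store {i j : ℕ} {l' : M.Label} (hl : M.code l = .store i j l') (hR : FitsIn s R)
    (hi : R i ≤ V) (hj : R j ≤ V)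
    (h : M.Good n w s U v ⟨l', Function.update R (R i) (R j), pos⟩ b) :
    M.Good n w s U v ⟨l, R, pos⟩ (b + (1 + 2 * V.size)) := by
  have h1 := Nat.size_le_size hi
  have h2 := Nat.size_le_size hj
  refine Good.mono (.step ⟨l, R, pos⟩ b ?_ hR ?_) ?_
  · simp [RAM.step, hl]
  · simpa [RAM.step, hl] using h
  · simp [RAM.cost, hl]; omega

theorem Good.jump {l' : M.Label} (hl : M.code l = .jump l') (hR : FitsIn s R)
    (h : M.Good n w s U v ⟨l', R, pos⟩ b) :
    M.Good n w s U v ⟨l, R, pos⟩ (b + (1 + 2 * V.size)) := by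
  refine Good.mono (.step ⟨l, R, pos⟩ b ?_ hR ?_) ?_
  · simp [RAM.step, hl]
  · simpa [RAM.step, hl] using h
  · simp [RAM.cost, hl]; omega

theorem Good.ifZero_of_eq {j : ℕ} {yes no : M.Label} (hl : M.code l = .ifZero j yes no)
    (hR : FitsIn s R) (hj : R j = 0) (h : M.Good n w s U v ⟨yes, R, pos⟩ b) :
    M.Good n w s U v ⟨l, R, pos⟩ (b + (1 + 2 * V.size)) := by
  refine Good.mono (.step ⟨l, R, pos⟩ b ?_ hR ?_) ?_
  · simp [RAM.step, hl]
  · simpa [RAM.step, hl, hj] using h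
  · simp [RAM.cost, hl, hj]; omega

theorem Good.ifZero_of_ne {j : ℕ} {yes no : M.Label} (hl : M.code l = .ifZero j yes no)
    (hR : FitsIn s R) (hj : R j ≠ 0) (hV : R j ≤ V) (h : M.Good n w s U v ⟨no, R, pos⟩ b) :
    M.Good n w s U v ⟨l, R, pos⟩ (b + (1 + 2 * V.size)) := by
  have h1 := Nat.size_le_size hV
  refine Good.mono (.step ⟨l, R, pos⟩ b ?_ hR ?_) ?_
  · simp [RAM.step, hl]
  · simpa [RAM.step, hl, hj] using h
  · simp [RAM.cost, hl]; omega

theorem Good.read_some {next : Option α → M.Label} (hl : M.code l = .read next)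
    (hR : FitsIn s R) (hpos : pos < w.length)
    (h : M.Good n w s U v ⟨next (some w[pos]), R, pos + 1⟩ (U (pos + 1))) :
    M.Good n w s U v ⟨l, R, pos⟩ (b + (1 + 2 * V.size)) := by
  refine Good.mono (.read ⟨l, R, pos⟩ b ?_ hR ?_) ?_
  · simp [RAM.step, hl, hpos]
  · simpa [RAM.step, hl, hpos] using h
  · simp [RAM.cost, hl]; omega

theorem Good.read_none {next : Option α → M.Label} (hl : M.code l = .read next)
    (hR : FitsIn s R) (hpos : w.length ≤ pos)
    (h : M.Good n w s U v ⟨next none, R, pos⟩ b) :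
    M.Good n w s U v ⟨l, R, pos⟩ (b + (1 + 2 * V.size)) := by
  refine Good.mono (.step ⟨l, R, pos⟩ b ?_ hR ?_) ?_
  · simp [RAM.step, hl, hpos]
  · simpa [RAM.step, hl, hpos] using h
  · simp [RAM.cost, hl]; omega

end Rules

end RAM

/-! ### The streaming machine -/

/-- An enumeration of a finite type: every element is reached from `first` by its `rank` many
applications of `next`. -/
structure RankEnum (σ : Type) where
  /-- the element of rank zero -/
  first : σ
  /-- the following element -/
  next : σ → σ
  /-- the number of an element -/
  rank : σ → ℕ
  /-- a bound for the ranks -/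
  bound : ℕ
  next_iterate_rank : ∀ s, next^[rank s] first = s
  rank_le : ∀ s, rank s ≤ bound

theorem RankEnum.nonempty (σ : Type) [Finite σ] [Nonempty σ] : Nonempty (RankEnum σ) := by
  obtain ⟨m, ⟨e⟩⟩ := Finite.exists_equiv_fin σ
  have : NeZero m := ⟨by rintro rfl; exact (e (Classical.arbitrary σ)).elim0⟩
  refine ⟨⟨e.symm 0, fun s => e.symm (e s + 1), fun s => e s, m, fun s => ?_,
    fun s => (e s).is_lt.le⟩⟩
  have h (j : ℕ) : (fun s => e.symm (e s + 1))^[j] (e.symm 0) = e.symm (Fin.ofNat m j) := by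
    induction j with
    | zero => rfl
    | succ j ih =>
      rw [Function.iterate_succ_apply', ih]
      simp only [Equiv.apply_symm_apply, EmbeddingLike.apply_eq_iff_eq]
      ext
      simp [Fin.val_add]
  rw [h]
  simp

namespace ShrinkingCA

variable {α : Type} (S : ShrinkingCA α)

/-- What is remembered of a received word: its last two letters (the letter before the first one
being `q`), or `none` if nothing has been received. -/
def summary : List S.Q → Option (S.Q × S.Q)
  | [] => none
  | y :: r => some (r.headD S.q, y)

/-- The summary after receiving one more letter. -/
def shift : Option (S.Q × S.Q) → S.Q → Option (S.Q × S.Q)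
  | none, z => some (S.q, z)
  | some (_, y), z => some (y, z)

open Classical in
/-- The letter handed on to the next configuration when one more letter is received, if any. -/
noncomputable def emit : Option (S.Q × S.Q) → S.Q → Option S.Q
  | none, _ => none
  | some (x, y), z => if S.δ x y z = S.del then none else some (S.δ x y z)

theorem shift_summary (u : List S.Q) (z : S.Q) :
    S.shift (S.summary u) z = S.summary (z :: u) := by
  cases u <;> rfl

theorem succWord_cons (u : List S.Q) (z : S.Q) :
    S.succWord (z :: u) = (S.emit (S.summary u) z).toList ++ S.succWord u := by
  rcases u with _ | ⟨y, r⟩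
  · rfl
  · rw [succWord, summary, emit]
    split_ifs <;> rfl

/-- The program labels of the streaming machine.  The letter being processed and the following two
bits are part of the label: `f` tells whether an accepting cell zero has been seen, and `d` whether
the input has come to its end. -/
inductive StreamLabel (Λ Q : Type) (k : ℕ) : Type
  | sim (l : Λ)
  | double (i : Fin (k + 1))
  | init (i : Fin 7)
  | clear
  | clearTest
  | clearDec
  | clearAddr
  | clearVal
  | clearStore
  | read (f : Bool)
  | feed (f d : Bool) (z : Q)
  | level (f d : Bool) (z : Q)
  | levelDec (f d : Bool) (z : Q)
  | levelAddr (f d : Bool) (z : Q)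
  | levelLoad (f d : Bool) (z : Q)
  | decode (f d : Bool) (z : Q) (s : Option (Q × Q))
  | decodeDec (f d : Bool) (z : Q) (s : Option (Q × Q))
  | levelVal (f d : Bool) (z : Q) (s : Option (Q × Q))
  | levelStore (f d : Bool) (o : Option Q)
  | drain (f : Bool)
  | drainTest (f : Bool)
  | drainDec (f : Bool)
  | output (f : Bool)
  | finished

set_option synthInstance.maxSize 1000 in
set_option synthInstance.maxHeartbeats 200000 in
instance (Λ Q : Type) (k : ℕ) [Finite Λ] [Finite Q] : Finite (StreamLabel Λ Q k) :=
  Finite.of_equiv _ (proxy_equiv% (StreamLabel Λ Q k))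

/-- Where to go after a letter has been processed. -/
def StreamLabel.fed {Λ Q : Type} {k : ℕ} (f d : Bool) : StreamLabel Λ Q k :=
  if d then .drainTest f else .read f

open Classical in
/-- The streaming machine.  It first runs `M₀`, which leaves a number in register `0`, and
multiplies it by `2 ^ k`; let `N` be the result.  It then keeps the summaries of the words received
by the configurations `0, …, N - 1`, configuration `τ` in register `8 + (N - 1 - τ)`.  A letter of
the input is fed to configuration `0`; whenever a configuration emits a letter, this is fed to the
next configuration.  After the input, `N` inactive letters are fed.

Register `1` counts the configurations that remain to be visited, register `2` the inactive letters
that remain to be fed, the registers `4` and `5` hold the address and the content of the current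
summary, and `3`, `6`, `7` the constants `8`, `0`, `1`. -/
noncomputable def streamRAM (M₀ : RAM Empty) (k : ℕ) (E : RankEnum (Option (S.Q × S.Q))) :
    RAM α where
  Label := StreamLabel M₀.Label S.Q k
  finite_Label :=
    have := M₀.finite_Label
    have := S.finite_Q
    inferInstance
  start := .sim M₀.start
  code
    | .sim l =>
      match M₀.code l with
      | .const i k next => .const i k (.sim next)
      | .add i j k next => .add i j k (.sim next)
      | .sub i j k next => .sub i j k (.sim next)
      | .half i j next => .half i j (.sim next)
      | .load i j next => .load i j (.sim next)
      | .store i j next => .store i j (.sim next)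
      | .jump next => .jump (.sim next)
      | .ifZero j yes no => .ifZero j (.sim yes) (.sim no)
      | .lenDigit j next => .lenDigit j (fun d => .sim (next d))
      | .read next => .jump (.sim (next none))
      | .halt => .jump (.double (Fin.last k))
    | .double ⟨0, _⟩ => .jump (.init 0)
    | .double ⟨i + 1, h⟩ => .add 0 0 0 (.double ⟨i, by omega⟩)
    | .init i => .const (i + 1) (![0, 0, 8, 0, 0, 0, 1] i) (if i = 6 then .clear else .init (i + 1))
    | .clear => .add 1 0 6 .clearTest
    | .clearTest => .ifZero 1 (.read false) .clearDec
    | .clearDec => .sub 1 1 7 .clearAddr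
    | .clearAddr => .add 4 1 3 .clearVal
    | .clearVal => .const 5 (E.rank none) .clearStore
    | .clearStore => .store 4 5 .clearTest
    | .read f => .read fun o => o.elim (.drain f) fun a => .feed f false (S.inp a)
    | .feed f d z => .add 1 0 6 (.level f d z)
    | .level f d z => .ifZero 1 (.fed f d) (.levelDec f d z)
    | .levelDec f d z => .sub 1 1 7 (.levelAddr f d z)
    | .levelAddr f d z => .add 4 1 3 (.levelLoad f d z)
    | .levelLoad f d z => .load 5 4 (.decode f d z E.first)
    | .decode f d z s => .ifZero 5 (.levelVal f d z s) (.decodeDec f d z s)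
    | .decodeDec f d z s => .sub 5 5 7 (.decode f d z (E.next s))
    | .levelVal f d z s => .const 5 (E.rank (S.shift s z))
        (.levelStore (f || decide (s = none ∧ z ∈ S.acc)) d (S.emit s z))
    | .levelStore f d o => .store 4 5 (o.elim (.fed f d) fun z => .level f d z)
    | .drain f => .add 2 0 6 (.drainTest f)
    | .drainTest f => .ifZero 2 (.output f) (.drainDec f)
    | .drainDec f => .sub 2 2 7 (.feed f true S.q)
    | .output f => .const 0 (if f then 1 else 0) .finished
    | .finished => .halt

/-! ### Register contents -/

/-- The register contents of the streaming machine after its initialization. -/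
def regs (N p c a x : ℕ) (lev : ℕ → ℕ) : ℕ → ℕ
  | 0 => N
  | 1 => p
  | 2 => c
  | 3 => 8
  | 4 => a
  | 5 => x
  | 6 => 0
  | 7 => 1
  | i + 8 => lev i

section regs

variable (N p c a x y : ℕ) (lev : ℕ → ℕ)

theorem update_regs_one :
    Function.update (regs N p c a x lev) 1 y = regs N y c a x lev := by
  funext i; rcases i with _ | _ | _ | _ | _ | _ | _ | _ | i <;> simp [regs, Function.update]

theorem update_regs_two :
    Function.update (regs N p c a x lev) 2 y = regs N p y a x lev := by
  funext i; rcases i with _ | _ | _ | _ | _ | _ | _ | _ | i <;> simp [regs, Function.update]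

theorem update_regs_four :
    Function.update (regs N p c a x lev) 4 y = regs N p c y x lev := by
  funext i; rcases i with _ | _ | _ | _ | _ | _ | _ | _ | i <;> simp [regs, Function.update]

theorem update_regs_five :
    Function.update (regs N p c a x lev) 5 y = regs N p c a y lev := by
  funext i; rcases i with _ | _ | _ | _ | _ | _ | _ | _ | i <;> simp [regs, Function.update]

theorem update_regs_add_eight (j : ℕ) :
    Function.update (regs N p c a x lev) (j + 8) y =
      regs N p c a x (Function.update lev j y) := by
  funext i; rcases i with _ | _ | _ | _ | _ | _ | _ | _ | i <;> simp [regs, Function.update]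

end regs

theorem update_init_eq_regs (R : ℕ → ℕ) :
    Function.update (Function.update (Function.update (Function.update (Function.update
      (Function.update (Function.update R 1 0) 2 0) 3 8) 4 0) 5 0) 6 0) 7 1 =
      regs (R 0) 0 0 0 0 fun i => R (i + 8) := by
  funext i; rcases i with _ | _ | _ | _ | _ | _ | _ | _ | i <;> simp [regs, Function.update]

/-- The registers `8, 9, …` hold, in descending order, the summaries of the words received by `p`
successive configurations, the first of which has received `u`. -/
def Encodes (E : RankEnum (Option (S.Q × S.Q))) (p : ℕ) (u : List S.Q) (lev : ℕ → ℕ) : Prop :=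
  ∀ i < p, lev i = E.rank (S.summary (S.succWord^[p - 1 - i] u))

variable {S}

theorem encodes_succ {E : RankEnum (Option (S.Q × S.Q))} {p : ℕ} {u : List S.Q} {lev : ℕ → ℕ} :
    S.Encodes E (p + 1) u lev ↔
      lev p = E.rank (S.summary u) ∧ S.Encodes E p (S.succWord u) lev := by
  have key (i : ℕ) (hi : i < p) :
      S.succWord^[p + 1 - 1 - i] u = S.succWord^[p - 1 - i] (S.succWord u) := by
    rw [← Function.iterate_succ_apply, show p + 1 - 1 - i = p - 1 - i + 1 by omega]
  constructor
  · intro h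
    refine ⟨by simpa using h p (by omega), fun i hi => ?_⟩
    rw [h i (by omega), key i hi]
  · rintro ⟨h0, h⟩ i hi
    obtain rfl | hi' := Nat.eq_or_lt_of_le (Nat.le_of_lt_succ hi)
    · simpa using h0
    · rw [h i hi', key i hi']

theorem Encodes.update {E : RankEnum (Option (S.Q × S.Q))} {p : ℕ} {u : List S.Q} {lev : ℕ → ℕ}
    (h : S.Encodes E p u lev) (y : ℕ) : S.Encodes E p u (Function.update lev p y) := by
  intro i hi
  rw [Function.update_of_ne hi.ne]
  exact h i hi

end ShrinkingCA

/-! ### Space -/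

/-- Register `a` holds at most `bnd a` bits, for every `a`. -/
def Within (bnd : ℕ → ℕ) (R : ℕ → ℕ) : Prop := ∀ a, Nat.size (R a) ≤ bnd a

theorem Within.update {bnd R : ℕ → ℕ} (h : Within bnd R) {a y : ℕ} (hy : Nat.size y ≤ bnd a) :
    Within bnd (Function.update R a y) := by
  intro i
  by_cases hi : i = a
  · subst hi; simpa using hy
  · rw [Function.update_of_ne hi]; exact h i

/-- The bounds `bnd` for the sizes of the registers are compatible with total space `s` and leave
room for numbers up to `V` in the registers `0, …, 7`, and for numbers up to `m` in the following
`N` registers. -/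
structure SpaceBound (s N V m : ℕ) (bnd : ℕ → ℕ) : Prop where
  eq_zero : ∀ a, s ≤ a → bnd a = 0
  sum_le : ∑ a ∈ Finset.range s, bnd a ≤ s
  low : ∀ a < 8, V.size ≤ bnd a
  high : ∀ i < N, m.size ≤ bnd (i + 8)
  le : N + 8 + m ≤ V

namespace SpaceBound

variable {s N V m : ℕ} {bnd : ℕ → ℕ}

theorem fitsIn (h : SpaceBound s N V m bnd) {R : ℕ → ℕ} (hR : Within bnd R) : FitsIn s R := by
  refine ⟨fun a ha => ?_, (Finset.sum_le_sum fun a _ => hR a).trans h.sum_le⟩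
  have := hR a
  rwa [h.eq_zero a ha, Nat.le_zero, Nat.size_eq_zero] at this

theorem within_regs (h : SpaceBound s N V m bnd) {p c a x : ℕ} {lev : ℕ → ℕ} (hp : p ≤ N)
    (hc : c ≤ N) (ha : a ≤ N + 8) (hx : x ≤ m) (hlev : Within (fun i => bnd (i + 8)) lev) :
    Within bnd (ShrinkingCA.regs N p c a x lev) := by
  have hV := h.le
  have key {y i : ℕ} (hy : y ≤ V) (hi : i < 8) : y.size ≤ bnd i :=
    (Nat.size_le_size hy).trans (h.low i hi)
  rintro (_ | _ | _ | _ | _ | _ | _ | _ | i)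
  case succ.succ.succ.succ.succ.succ.succ.succ => exact hlev i
  all_goals exact key (by simp only [ShrinkingCA.regs]; omega) (by omega)

theorem fitsIn_regs (h : SpaceBound s N V m bnd) {p c a x : ℕ} {lev : ℕ → ℕ} (hp : p ≤ N)
    (hc : c ≤ N) (ha : a ≤ N + 8) (hx : x ≤ m) (hlev : Within (fun i => bnd (i + 8)) lev) :
    FitsIn s (ShrinkingCA.regs N p c a x lev) :=
  h.fitsIn (h.within_regs hp hc ha hx hlev)

theorem within_update (h : SpaceBound s N V m bnd) {lev : ℕ → ℕ} {i y : ℕ}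
    (hlev : Within (fun i => bnd (i + 8)) lev) (hi : i < N) (hy : y ≤ m) :
    Within (fun i => bnd (i + 8)) (Function.update lev i y) :=
  hlev.update ((Nat.size_le_size hy).trans (h.high i hi))

end SpaceBound

/-! ### Correctness and cost of the streaming machine -/

namespace ShrinkingCA

open RAM

variable {α : Type} {S : ShrinkingCA α} {M₀ : RAM Empty} {k : ℕ}
  {E : RankEnum (Option (S.Q × S.Q))} {n : ℕ} {w : List α} {s N V : ℕ} {U : ℕ → ℕ} {v : ℕ}
  {bnd : ℕ → ℕ} {pos b : ℕ}

/-- Counting the content `x` of register `5` down to zero turns it into the label of rank `x`. -/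
theorem good_decode (hs : SpaceBound s N V E.bound bnd) {f d : Bool} {z : S.Q} {p c a x : ℕ}
    {lev : ℕ → ℕ} (hp : p ≤ N) (hc : c ≤ N) (ha : a ≤ N + 8) (hx : x ≤ E.bound)
    (hlev : Within (fun i => bnd (i + 8)) lev) (t : Option (S.Q × S.Q))
    (h : (S.streamRAM M₀ k E).Good n w s U v
      ⟨.levelVal f d z (E.next^[x] t), regs N p c a 0 lev, pos⟩ b) :
    (S.streamRAM M₀ k E).Good n w s U v
      ⟨.decode f d z t, regs N p c a x lev, pos⟩ (b + (2 * x + 1) * (1 + 2 * V.size)) := by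
  have hV := hs.le
  induction x generalizing t with
  | zero =>
    exact (Good.ifZero_of_eq (V := V) (b := b) rfl (hs.fitsIn_regs hp hc ha hx hlev) rfl h).mono
      (by omega)
  | succ x ih =>
    have h1 := hs.fitsIn_regs hp hc ha hx hlev
    refine Good.mono (Good.ifZero_of_ne (V := V)
      (b := b + (2 * x + 1) * (1 + 2 * V.size) + (1 + 2 * V.size)) rfl h1
      (Nat.succ_ne_zero x) (by simp only [regs]; omega) ?_) (by linarith)
    refine Good.sub (V := V) rfl h1 (by simp only [regs]; omega) (by simp only [regs]; omega) ?_
    rw [update_regs_five]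
    exact ih (by omega) _ h

open Classical in
/-- Feeding the letter `z` to one configuration. -/
theorem good_level_one (hs : SpaceBound s N V E.bound bnd) {f d : Bool} {z : S.Q} {u : List S.Q}
    {p c a x : ℕ} {lev : ℕ → ℕ} (hp : p < N) (hc : c ≤ N) (ha : a ≤ N + 8) (hx : x ≤ E.bound)
    (hlev : Within (fun i => bnd (i + 8)) lev) (h0 : lev p = E.rank (S.summary u))
    (h : (S.streamRAM M₀ k E).Good n w s U v
      ⟨((S.emit (S.summary u) z).elim
          (.fed (f || decide (S.summary u = none ∧ z ∈ S.acc)) d)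
          (fun z' => .level (f || decide (S.summary u = none ∧ z ∈ S.acc)) d z') :
          StreamLabel M₀.Label S.Q k),
        regs N p c (p + 8) (E.rank (S.summary (z :: u)))
          (Function.update lev p (E.rank (S.summary (z :: u)))), pos⟩ b) :
    (S.streamRAM M₀ k E).Good n w s U v ⟨.level f d z, regs N (p + 1) c a x lev, pos⟩
      (b + (2 * E.bound + 7) * (1 + 2 * V.size)) := by
  have hV := hs.le
  have hr : lev p ≤ E.bound := h0 ▸ E.rank_le _
  have hr' := E.rank_le (S.summary (z :: u))
  have hle : b + (1 + 2 * V.size) + (1 + 2 * V.size) + (2 * lev p + 1) * (1 + 2 * V.size)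
      + (1 + 2 * V.size) + (1 + 2 * V.size) + (1 + 2 * V.size) + (1 + 2 * V.size) ≤
      b + (2 * E.bound + 7) * (1 + 2 * V.size) := by
    have : (2 * lev p + 1) * (1 + 2 * V.size) ≤ (2 * E.bound + 1) * (1 + 2 * V.size) :=
      Nat.mul_le_mul_right _ (by omega)
    linarith
  have h1 := hs.fitsIn_regs hp hc ha hx hlev
  refine Good.mono (Good.ifZero_of_ne (V := V) rfl h1 (Nat.succ_ne_zero p)
    (by simp only [regs]; omega) ?_) hle
  refine Good.sub (V := V) rfl h1 (by simp only [regs]; omega) (by simp only [regs]; omega) ?_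
  rw [update_regs_one]
  refine Good.add (V := V) rfl (hs.fitsIn_regs hp.le hc ha hx hlev)
    (by simp only [regs]; omega) (by simp only [regs]; omega) ?_
  rw [update_regs_four]
  have ha' : p + 8 ≤ N + 8 := by omega
  refine Good.load (V := V) rfl (hs.fitsIn_regs hp.le hc ha' hx hlev)
    (by simp only [regs]; omega) (by simp only [regs, Nat.add_sub_cancel]; omega) ?_
  rw [update_regs_five]
  refine good_decode hs hp.le hc ha' hr hlev _ ?_
  rw [h0, E.next_iterate_rank]
  refine Good.const (V := V) rfl (hs.fitsIn_regs hp.le hc ha' (Nat.zero_le _) hlev)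
    (by have := E.rank_le (S.shift (S.summary u) z); omega) ?_
  rw [update_regs_five, shift_summary]
  refine Good.store (V := V) rfl (hs.fitsIn_regs hp.le hc ha' hr' hlev)
    (by simp only [regs]; omega) (by simp only [regs]; omega) ?_
  have := update_regs_add_eight N p c (p + 8) (E.rank (S.summary (z :: u)))
    (E.rank (S.summary (z :: u))) lev p
  rw [← this] at h
  exact h

open Classical in
/-- Feeding the letter `z` to the first of `p` successive configurations, the letters emitted being
fed on.  The proposition `X` stands for the knowledge about the configurations already passed. -/
theorem good_level (hs : SpaceBound s N V E.bound bnd) {d : Bool} {c : ℕ} (hc : c ≤ N)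
    (p : ℕ) (hp : p ≤ N) : ∀ (u : List S.Q) (z : S.Q) (f : Bool) (X : Prop) (a x : ℕ)
      (lev : ℕ → ℕ), a ≤ N + 8 → x ≤ E.bound → Within (fun i => bnd (i + 8)) lev →
      S.Encodes E p u lev → (f = true ↔ X ∨ S.AccWord p u) →
      (∀ f' p' a' x' lev', p' ≤ N → a' ≤ N + 8 → x' ≤ E.bound →
        Within (fun i => bnd (i + 8)) lev' → (∀ i, p ≤ i → lev' i = lev i) →
        S.Encodes E p (z :: u) lev' → (f' = true ↔ X ∨ S.AccWord p (z :: u)) →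
        (S.streamRAM M₀ k E).Good n w s U v ⟨.fed f' d, regs N p' c a' x' lev', pos⟩ b) →
      (S.streamRAM M₀ k E).Good n w s U v ⟨.level f d z, regs N p c a x lev, pos⟩
        (b + ((2 * E.bound + 7) * p + 1) * (1 + 2 * V.size)) := by
  induction p with
  | zero =>
    intro u z f X a x lev ha hx hlev henc hf h
    refine (Good.ifZero_of_eq (V := V) (b := b) rfl (hs.fitsIn_regs hp hc ha hx hlev)
      rfl ?_).mono (by simp)
    refine h f 0 a x lev hp ha hx hlev (fun _ _ => rfl) (fun i hi => by omega) ?_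
    simpa [not_accWord_zero] using hf
  | succ p ih =>
    intro u z f X a x lev ha hx hlev henc hf h
    rw [encodes_succ] at henc
    obtain ⟨h0, henc⟩ := henc
    have hr' := E.rank_le (S.summary (z :: u))
    have hw₁ := hs.within_update hlev hp hr'
    have hf₁ : (f || decide (S.summary u = none ∧ z ∈ S.acc)) = true ↔
        (X ∨ ∃ a ∈ (z :: u).getLast?, a ∈ S.acc) ∨ S.AccWord p (S.succWord u) := by
      rw [Bool.or_eq_true, decide_eq_true_iff, hf, accWord_succ]
      rcases u with _ | ⟨y, r⟩
      · simp [summary, not_accWord_nil, succWord]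
      · simp only [summary, List.getLast?_cons_cons, reduceCtorEq, false_and, or_false, or_assoc]
    refine Good.mono (good_level_one hs hp hc ha hx hlev h0
      (b := b + ((2 * E.bound + 7) * p + 1) * (1 + 2 * V.size)) ?_) (by linarith)
    have hc' := S.succWord_cons u z
    cases ho : S.emit (S.summary u) z with
    | none =>
      rw [ho, Option.toList_none, List.nil_append] at hc'
      refine (h _ _ _ _ _ (by omega) (by omega) hr' hw₁ (fun i hi => ?_) ?_ ?_).mono
        (Nat.le_add_right _ _)
      · rw [Function.update_of_ne (by omega)]
      · rw [encodes_succ, hc']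
        exact ⟨by simp, henc.update _⟩
      · rw [hf₁, accWord_succ, hc', or_assoc]
    | some o =>
      rw [ho, Option.toList_some, List.singleton_append] at hc'
      refine ih (by omega) (S.succWord u) o _ (X ∨ ∃ a ∈ (z :: u).getLast?, a ∈ S.acc) _ _ _
        (by omega) hr' hw₁ (henc.update _) hf₁ ?_
      intro f' p' a' x' lev' hp' ha' hx' hw' hl' he' hf'
      refine h f' p' a' x' lev' hp' ha' hx' hw' (fun i hi => ?_) ?_ ?_
      · rw [hl' i (by omega), Function.update_of_ne (by omega)]
      · rw [encodes_succ, hc']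
        exact ⟨by rw [hl' p le_rfl]; simp, he'⟩
      · rw [hf', accWord_succ, hc', or_assoc]

/-- The state of the machine between two letters: the registers encode the received word `u`, and
the bit `f` tells whether an accepting cell zero is known. -/
structure Ready (E : RankEnum (Option (S.Q × S.Q))) (bnd : ℕ → ℕ) (N : ℕ) (u : List S.Q) (f : Bool)
    (p a x : ℕ) (lev : ℕ → ℕ) : Prop where
  p_le : p ≤ N
  a_le : a ≤ N + 8
  x_le : x ≤ E.bound
  within : Within (fun i => bnd (i + 8)) lev
  encodes : S.Encodes E N u lev
  iff : f = true ↔ S.AccWord N u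

theorem good_feed (hs : SpaceBound s N V E.bound bnd) {f d : Bool} {z : S.Q} {u : List S.Q}
    {p c a x : ℕ} {lev : ℕ → ℕ} (hc : c ≤ N) (hu : Ready E bnd N u f p a x lev)
    (h : ∀ f' p' a' x' lev', Ready E bnd N (z :: u) f' p' a' x' lev' →
      (S.streamRAM M₀ k E).Good n w s U v ⟨.fed f' d, regs N p' c a' x' lev', pos⟩ b) :
    (S.streamRAM M₀ k E).Good n w s U v ⟨.feed f d z, regs N p c a x lev, pos⟩
      (b + ((2 * E.bound + 7) * N + 2) * (1 + 2 * V.size)) := by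
  have hV := hs.le
  refine Good.mono (Good.add (V := V)
    (b := b + ((2 * E.bound + 7) * N + 1) * (1 + 2 * V.size)) rfl
    (hs.fitsIn_regs hu.p_le hc hu.a_le hu.x_le hu.within)
    (by simp only [regs]; omega) (by simp only [regs]; omega) ?_) (by linarith)
  rw [update_regs_one]
  refine good_level hs hc N le_rfl u z f False a x lev hu.a_le hu.x_le hu.within hu.encodes
    (by simpa using hu.iff) ?_
  intro f' p' a' x' lev' hp' ha' hx' hw' _ he' hf'
  exact h f' p' a' x' lev' ⟨hp', ha', hx', hw', he', by simpa using hf'⟩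

open Classical in
/-- Feeding the remaining `c` inactive letters after the input, and giving the answer. -/
theorem good_drainTest (hs : SpaceBound s N V E.bound bnd) (c : ℕ) (hc : c ≤ N) :
    ∀ (u : List S.Q) (f : Bool) (p a x : ℕ) (lev : ℕ → ℕ), Ready E bnd N u f p a x lev →
      v = (if S.AccWord N (List.replicate c S.q ++ u) then 1 else 0) →
      (S.streamRAM M₀ k E).Good n w s U v ⟨.drainTest f, regs N p c a x lev, pos⟩
        ((((2 * E.bound + 7) * N + 4) * c + 2) * (1 + 2 * V.size)) := by
  have hV := hs.le
  induction c with
  | zero =>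
    intro u f p a x lev hu hv
    refine Good.mono (Good.ifZero_of_eq (V := V) rfl
      (hs.fitsIn_regs hu.p_le hc hu.a_le hu.x_le hu.within) rfl ?_)
      (b := 1 + 2 * V.size + (1 + 2 * V.size)) (by linarith)
    have hfit := hs.within_regs hu.p_le hc hu.a_le hu.x_le hu.within
    have hv1 : (if f then 1 else 0) ≤ 1 := by split_ifs <;> omega
    refine Good.mono (Good.const (V := V) (b := 0) rfl (hs.fitsIn hfit) (by omega) ?_) (by omega)
    refine .halt _ _ rfl (hs.fitsIn (hfit.update ?_)) ?_
    · exact (Nat.size_le_size (by omega)).trans (hs.low 0 (by omega))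
    · change Function.update (regs N p 0 a x lev) 0 (if f then 1 else 0) 0 = v
      rw [Function.update_self, hv]
      simp only [hu.iff, List.replicate_zero, List.nil_append]
  | succ c ih =>
    intro u f p a x lev hu hv
    refine Good.mono (Good.ifZero_of_ne (V := V) rfl
      (hs.fitsIn_regs hu.p_le hc hu.a_le hu.x_le hu.within) (Nat.succ_ne_zero c)
      (by simp only [regs]; omega) ?_)
      (b := (((2 * E.bound + 7) * N + 4) * c + 2) * (1 + 2 * V.size)
        + ((2 * E.bound + 7) * N + 2) * (1 + 2 * V.size) + (1 + 2 * V.size)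
        + (1 + 2 * V.size)) (by linarith)
    refine Good.sub (V := V) rfl (hs.fitsIn_regs hu.p_le hc hu.a_le hu.x_le hu.within)
      (by simp only [regs]; omega) (by simp only [regs]; omega) ?_
    rw [update_regs_two]
    refine good_feed hs (by simp only [regs]; omega) hu ?_
    intro f' p' a' x' lev' hu'
    refine ih (by omega) (S.q :: u) f' p' a' x' lev' hu' ?_
    rw [hv, List.replicate_succ', List.append_assoc, List.singleton_append]

open Classical in
/-- Reading the rest of the input, from position `w.length - j` on. -/
theorem good_read (hs : SpaceBound s N V E.bound bnd)
    (hv : v = if S.AccWord N (revPrefix (S.rightHalf w 0) (w.length + N)) then 1 else 0)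
    (hU : ∀ i < w.length, ((2 * E.bound + 7) * N + 3) * (1 + 2 * V.size) ≤ U i)
    (hU' : (((2 * E.bound + 7) * N + 4) * (N + 1) + 2) * (1 + 2 * V.size) ≤ U w.length)
    {c : ℕ} (hc : c ≤ N) (j : ℕ) (hj : j ≤ w.length) :
    ∀ (f : Bool) (p a x : ℕ) (lev : ℕ → ℕ),
      Ready E bnd N (revPrefix (S.rightHalf w 0) (w.length - j)) f p a x lev →
      (S.streamRAM M₀ k E).Good n w s U v ⟨.read f, regs N p c a x lev, w.length - j⟩
        (if j = 0 then (((2 * E.bound + 7) * N + 4) * N + 4) * (1 + 2 * V.size)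
          else 1 + 2 * V.size) := by
  have hV := hs.le
  induction j with
  | zero =>
    intro f p a x lev hu
    rw [Nat.sub_zero] at hu ⊢
    refine Good.mono (Good.read_none (V := V) rfl
      (hs.fitsIn_regs hu.p_le hc hu.a_le hu.x_le hu.within) le_rfl ?_)
      (b := (((2 * E.bound + 7) * N + 4) * N + 2) * (1 + 2 * V.size) + (1 + 2 * V.size)
        + (1 + 2 * V.size)) (by rw [if_pos rfl]; linarith)
    refine Good.add (V := V) rfl (hs.fitsIn_regs hu.p_le hc hu.a_le hu.x_le hu.within)
      (by simp only [regs]; omega) (by simp only [regs]; omega) ?_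
    rw [update_regs_two]
    refine good_drainTest hs N le_rfl _ f p a x lev hu ?_
    rw [hv, revPrefix_add_of_eq _ S.q _ _ (S.rightHalf_zero_of_le w)]
  | succ j ih =>
    intro f p a x lev hu
    have hlt : w.length - (j + 1) < w.length := by omega
    refine Good.mono (Good.read_some (V := V) (b := 0) rfl
      (hs.fitsIn_regs hu.p_le hc hu.a_le hu.x_le hu.within) hlt ?_) (by simp)
    have hpos : w.length - (j + 1) + 1 = w.length - j := by omega
    rw [hpos]
    have hfeed := good_feed (S := S) (M₀ := M₀) (k := k) (n := n) (w := w) (U := U) (v := v)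
      (pos := w.length - j) hs (d := false) (z := S.inp w[w.length - (j + 1)]) hc hu
      (fun f' p' a' x' lev' hu' => by
        refine ih (by omega) f' p' a' x' lev' ?_
        rw [← hpos, revPrefix, S.rightHalf_zero_of_lt w _ hlt]
        exact hu')
    refine hfeed.mono ?_
    by_cases h0 : j = 0
    · subst h0
      rw [Nat.sub_zero]
      refine le_trans ?_ hU'
      rw [if_pos rfl, ← add_mul]
      exact Nat.mul_le_mul_right _ (by linarith)
    · rw [if_neg h0]
      refine le_trans ?_ (hU _ (by omega))
      linarith

/-! ### The initialization and the whole run -/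

/-- Emptying the remaining `p` summaries, so that no configuration has received anything. -/
theorem good_clearTest (hs : SpaceBound s N V E.bound bnd)
    (h : ∀ p a x lev, Ready E bnd N [] false p a x lev →
      (S.streamRAM M₀ k E).Good n w s U v ⟨.read false, regs N p 0 a x lev, pos⟩ b)
    (p : ℕ) (hp : p ≤ N) : ∀ (a x : ℕ) (lev : ℕ → ℕ), a ≤ N + 8 → x ≤ E.bound →
      Within (fun i => bnd (i + 8)) lev → (∀ i, p ≤ i → i < N → lev i = E.rank none) →
      (S.streamRAM M₀ k E).Good n w s U v ⟨.clearTest, regs N p 0 a x lev, pos⟩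
        (b + (5 * p + 1) * (1 + 2 * V.size)) := by
  have hV := hs.le
  induction p with
  | zero =>
    intro a x lev ha hx hlev hnone
    refine Good.mono (Good.ifZero_of_eq (V := V) (b := b) rfl
      (hs.fitsIn_regs hp (Nat.zero_le _) ha hx hlev) rfl ?_) (by linarith)
    refine h _ _ _ _ ⟨hp, ha, hx, hlev, fun i hi => ?_, by simp [not_accWord_nil]⟩
    rw [hnone i (Nat.zero_le _) hi, succWord_iterate_nil]
    rfl
  | succ p ih =>
    intro a x lev ha hx hlev hnone
    have hr := E.rank_le none
    have h1 := hs.fitsIn_regs hp (Nat.zero_le _) ha hx hlev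
    have hp' : p ≤ N := by omega
    have ha' : p + 8 ≤ N + 8 := by omega
    refine Good.mono (Good.ifZero_of_ne (V := V) rfl h1 (Nat.succ_ne_zero p)
      (by simp only [regs]; omega) ?_)
      (b := b + (5 * p + 1) * (1 + 2 * V.size) + (1 + 2 * V.size) + (1 + 2 * V.size)
        + (1 + 2 * V.size) + (1 + 2 * V.size) + (1 + 2 * V.size)) (by linarith)
    refine Good.sub (V := V) rfl h1 (by simp only [regs]; omega) (by simp only [regs]; omega) ?_
    rw [update_regs_one]
    refine Good.add (V := V) rfl (hs.fitsIn_regs hp' (Nat.zero_le _) ha hx hlev)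
      (by simp only [regs]; omega) (by simp only [regs]; omega) ?_
    rw [update_regs_four]
    refine Good.const (V := V) rfl (hs.fitsIn_regs hp' (Nat.zero_le _) ha' hx hlev)
      (by omega) ?_
    rw [update_regs_five]
    refine Good.store (V := V) rfl (hs.fitsIn_regs hp' (Nat.zero_le _) ha' hr hlev)
      (by simp only [regs]; omega) (by simp only [regs]; omega) ?_
    have := ih hp' (p + 8) (E.rank none) (Function.update lev p (E.rank none)) ha' hr
      (hs.within_update hlev hp hr) (fun i hi hi' => ?_)
    · rw [← update_regs_add_eight] at this
      exact this
    · obtain rfl | hi := Nat.eq_or_lt_of_le hi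
      · simp
      · rw [Function.update_of_ne (by omega)]
        exact hnone i hi hi'

/-- Setting the registers `1, …, 7`, whatever `M₀` has left there, and emptying the summaries. -/
theorem good_init (hs : SpaceBound s N V E.bound bnd)
    (h : ∀ p a x lev, Ready E bnd N [] false p a x lev →
      (S.streamRAM M₀ k E).Good n w s U v ⟨.read false, regs N p 0 a x lev, pos⟩ b)
    {R : ℕ → ℕ} (hR : Within bnd R) (h0 : R 0 = N) :
    (S.streamRAM M₀ k E).Good n w s U v ⟨.init 0, R, pos⟩
      (b + (5 * N + 9) * (1 + 2 * V.size)) := by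
  have hV := hs.le
  have upd {R : ℕ → ℕ} (hR : Within bnd R) {i y : ℕ} (hi : i < 8) (hy : y ≤ V) :
      Within bnd (Function.update R i y) :=
    hR.update ((Nat.size_le_size hy).trans (hs.low i hi))
  refine Good.mono (Good.const (i := 1) (k := 0) (l' := StreamLabel.init 1) (V := V) rfl
    (hs.fitsIn hR) (by omega) ?_)
    (b := b + (5 * N + 1) * (1 + 2 * V.size) + (1 + 2 * V.size) + (1 + 2 * V.size)
      + (1 + 2 * V.size) + (1 + 2 * V.size) + (1 + 2 * V.size) + (1 + 2 * V.size)
      + (1 + 2 * V.size) + (1 + 2 * V.size)) (by linarith)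
  replace hR := upd hR (i := 1) (y := 0) (by omega) (by omega)
  refine Good.const (i := 2) (k := 0) (l' := StreamLabel.init 2) (V := V) rfl
    (hs.fitsIn hR) (by omega) ?_
  replace hR := upd hR (i := 2) (y := 0) (by omega) (by omega)
  refine Good.const (i := 3) (k := 8) (l' := StreamLabel.init 3) (V := V) rfl
    (hs.fitsIn hR) (by omega) ?_
  replace hR := upd hR (i := 3) (y := 8) (by omega) (by omega)
  refine Good.const (i := 4) (k := 0) (l' := StreamLabel.init 4) (V := V) rfl
    (hs.fitsIn hR) (by omega) ?_
  replace hR := upd hR (i := 4) (y := 0) (by omega) (by omega)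
  refine Good.const (i := 5) (k := 0) (l' := StreamLabel.init 5) (V := V) rfl
    (hs.fitsIn hR) (by omega) ?_
  replace hR := upd hR (i := 5) (y := 0) (by omega) (by omega)
  refine Good.const (i := 6) (k := 0) (l' := StreamLabel.init 6) (V := V) rfl
    (hs.fitsIn hR) (by omega) ?_
  replace hR := upd hR (i := 6) (y := 0) (by omega) (by omega)
  refine Good.const (i := 7) (k := 1) (l' := StreamLabel.clear) (V := V) rfl
    (hs.fitsIn hR) (by omega) ?_
  replace hR := upd hR (i := 7) (y := 1) (by omega) (by omega)
  rw [update_init_eq_regs] at hR ⊢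
  rw [h0] at hR ⊢
  have hlev := fun i => hR (i + 8)
  refine Good.add (V := V) rfl (hs.fitsIn hR)
    (by simp only [regs]; omega) (by simp only [regs]; omega) ?_
  rw [update_regs_one]
  exact good_clearTest hs h N le_rfl _ _ _ (by omega) (by omega) hlev (fun i hi hi' => by omega)

/-- Doubling register `0` another `i` times. -/
theorem good_double (hs : SpaceBound s N V E.bound bnd)
    (h : ∀ R : ℕ → ℕ, Within bnd R → R 0 = N →
      (S.streamRAM M₀ k E).Good n w s U v ⟨.init 0, R, pos⟩ b) (i : ℕ) (hi : i < k + 1) :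
    ∀ R : ℕ → ℕ, Within bnd R → 2 ^ i * R 0 = N →
      (S.streamRAM M₀ k E).Good n w s U v ⟨.double ⟨i, hi⟩, R, pos⟩
        (b + (i + 1) * (1 + 2 * V.size)) := by
  have hV := hs.le
  induction i with
  | zero =>
    intro R hR h0
    refine Good.mono (Good.jump (V := V) rfl (hs.fitsIn hR) (h R hR (by simpa using h0)))
      (by linarith)
  | succ i ih =>
    intro R hR h0
    have h2 : 2 ^ i * (R 0 + R 0) = N := by rw [← h0]; ring
    have h3 : R 0 + R 0 ≤ N := by
      rw [← h2]; exact Nat.le_mul_of_pos_left _ (by positivity)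
    refine Good.mono (Good.add (V := V) rfl (hs.fitsIn hR) (by omega) (by omega) (ih (by omega)
      (Function.update R 0 (R 0 + R 0))
      (hR.update ((Nat.size_le_size (by omega)).trans (hs.low 0 (by omega))))
      (by simpa using h2))) (by linarith)

theorem step_sim (c : RAMCfg M₀.Label) (h : M₀.code c.label ≠ .halt) :
    (S.streamRAM M₀ k E).step n w ⟨.sim c.label, c.reg, pos⟩ =
      ⟨.sim (M₀.step n [] c).label, (M₀.step n [] c).reg, pos⟩ := by
  cases hc : M₀.code c.label <;> simp_all [RAM.step, streamRAM]
  case ifZero => split_ifs <;> rfl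

theorem cost_sim (c : RAMCfg M₀.Label) (h : M₀.code c.label ≠ .halt) :
    (S.streamRAM M₀ k E).cost ⟨.sim c.label, c.reg, pos⟩ = M₀.cost c := by
  cases hc : M₀.code c.label <;> simp_all [RAM.cost, streamRAM]

/-- The first `j` steps of `M₀` are carried out at the same cost. -/
theorem good_sim (hfit : ∀ j, FitsIn s (M₀.run n [] j).reg) (j : ℕ)
    (h : (S.streamRAM M₀ k E).Good n w s U v
      ⟨.sim (M₀.run n [] j).label, (M₀.run n [] j).reg, pos⟩ b) :
    (S.streamRAM M₀ k E).Good n w s U v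
      ⟨.sim M₀.start, fun _ => 0, pos⟩ (b + M₀.totalOps n [] j) := by
  induction j generalizing b with
  | zero => simpa [totalOps, RAM.run, RAM.initCfg] using h
  | succ j ih =>
    have hrun : M₀.run n [] (j + 1) = M₀.step n [] (M₀.run n [] j) :=
      Function.iterate_succ_apply' _ _ _
    rw [totalOps, Finset.sum_range_succ, ← totalOps, add_comm (M₀.totalOps n [] j), ← add_assoc]
    apply ih
    by_cases hh : M₀.code (M₀.run n [] j).label = .halt
    · rw [hrun, step_of_halt hh] at h
      exact h.mono (Nat.le_add_right _ _)
    · rw [hrun] at h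
      rw [add_comm b, ← cost_sim (S := S) (k := k) (E := E) (pos := pos) _ hh]
      have hstep := step_sim (S := S) (k := k) (E := E) (n := n) (w := w) (pos := pos) _ hh
      refine .step _ _ ?_ (hfit j) ?_
      · have hpos := congrArg RAMCfg.pos hstep
        exact hpos
      · exact hstep ▸ h

open Classical in
/-- The whole run of the streaming machine on a non-empty word. -/
theorem good_initCfg (hs : SpaceBound s N V E.bound bnd) (hw : w ≠ [])
    (hfit : ∀ j, FitsIn s (M₀.run n [] j).reg) {j : ℕ}
    (hhalt : M₀.code (M₀.run n [] j).label = .halt)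
    (hout : 2 ^ k * (M₀.run n [] j).reg 0 = N) (hR : Within bnd (M₀.run n [] j).reg)
    (hv : v = if S.AccWord N (revPrefix (S.rightHalf w 0) (w.length + N)) then 1 else 0)
    (hU : ∀ i < w.length, ((2 * E.bound + 7) * N + 3) * (1 + 2 * V.size) ≤ U i)
    (hU' : (((2 * E.bound + 7) * N + 4) * (N + 1) + 2) * (1 + 2 * V.size) ≤ U w.length) :
    (S.streamRAM M₀ k E).Good n w s U v (S.streamRAM M₀ k E).initCfg
      ((5 * N + k + 12) * (1 + 2 * V.size) + M₀.totalOps n [] j) := by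
  refine good_sim hfit j ?_
  refine Good.mono (Good.jump (V := V) (l' := StreamLabel.double (Fin.last k)) ?_ (hfit j)
    (good_double hs (fun R hR hR0 => good_init hs (fun p a x lev hr => ?_) hR hR0)
      k (Nat.lt_succ_self k) _ hR hout)) (b := 1 + 2 * V.size + (5 * N + 9) * (1 + 2 * V.size)
        + (k + 1) * (1 + 2 * V.size) + (1 + 2 * V.size)) (by linarith)
  · simp [streamRAM, hhalt]
  · have := good_read (n := n) (M₀ := M₀) (k := k) hs hv hU hU' (Nat.zero_le N) w.length le_rfl
      false p a x lev (by rw [Nat.sub_self]; exact hr)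
    rwa [Nat.sub_self, if_neg (by simpa using hw)] at this

end ShrinkingCA

/-! ### Resource bounds -/

theorem Nat.size_mul_le (a b : ℕ) : Nat.size (a * b) ≤ Nat.size a + Nat.size b := by
  rw [Nat.size_le, pow_add]
  exact Nat.mul_lt_mul'' (Nat.lt_size_self a) (Nat.lt_size_self b)

theorem Nat.size_le_self (a : ℕ) : Nat.size a ≤ a := Nat.size_le.2 Nat.lt_two_pow_self

theorem size_le_lg (x : ℕ) : Nat.size x ≤ lg x :=
  Nat.size_le.2 (Nat.lt_pow_succ_log_self (by omega) x)

theorem FitsIn.sum_size_eq {s s' : ℕ} {R : ℕ → ℕ} (h : FitsIn s R) (hs : s ≤ s') :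
    ∑ a ∈ Finset.range s', Nat.size (R a) = ∑ a ∈ Finset.range s, Nat.size (R a) := by
  refine (Finset.sum_subset (Finset.range_mono hs) fun a _ ha => ?_).symm
  rw [h.1 a (by simpa using ha), Nat.size_zero]

theorem FitsIn.mono {s s' : ℕ} {R : ℕ → ℕ} (h : FitsIn s R) (hs : s ≤ s') : FitsIn s' R := by
  refine ⟨fun a ha => h.1 a (hs.trans ha), ?_⟩
  rw [h.sum_size_eq hs]
  exact h.2.trans hs

theorem one_add_two_mul_size_le {T K V : ℕ} (hV : V ≤ T * K) :
    1 + 2 * V.size ≤ (3 + 2 * K) * lg T := by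
  have h1 : V.size ≤ lg T + K :=
    (Nat.size_le_size hV).trans
      ((Nat.size_mul_le T K).trans (add_le_add (size_le_lg T) (Nat.size_le_self K)))
  have h2 : 1 ≤ lg T := Nat.le_add_left _ _
  nlinarith

/-- With `P * T` configurations, all resource bounds are as required, up to a constant factor. -/
theorem exists_resource_const (c₀ k m P : ℕ) : ∃ c, ∀ T, 0 < T →
    let V := P * T + 8 + m
    c₀ * T + 8 * V + P * T * m + (P * T + 8) ≤ c * T ∧
    ((2 * m + 7) * (P * T) + 3) * (1 + 2 * V.size) ≤ c * (T * lg T) ∧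
    (((2 * m + 7) * (P * T) + 4) * (P * T + 1) + 2) * (1 + 2 * V.size) ≤ c * (T ^ 2 * lg T) ∧
    (5 * (P * T) + k + 12) * (1 + 2 * V.size) + c₀ * (T * lg T) ≤ c * (T * lg T) := by
  obtain ⟨D, hD⟩ : ∃ D, D = 3 + 2 * (P + 8 + m) := ⟨_, rfl⟩
  obtain ⟨e₀, he₀⟩ : ∃ e, e = c₀ + 8 * (P + 8 + m) + P * m + P + 8 := ⟨_, rfl⟩
  obtain ⟨e₁, he₁⟩ : ∃ e, e = (2 * m + 7) * P + 3 := ⟨_, rfl⟩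
  obtain ⟨e₂, he₂⟩ : ∃ e, e = ((2 * m + 7) * P + 4) * (P + 1) + 2 := ⟨_, rfl⟩
  obtain ⟨e₃, he₃⟩ : ∃ e, e = 5 * P + k + 12 := ⟨_, rfl⟩
  refine ⟨e₀ + e₁ * D + e₂ * D + (e₃ * D + c₀), fun T hT => ?_⟩
  intro V
  have hV : V ≤ T * (P + 8 + m) := by
    have h1 : 8 ≤ T * 8 := by omega
    have h2 : m ≤ T * m := Nat.le_mul_of_pos_left _ hT
    calc V = P * T + 8 + m := rfl
      _ ≤ T * P + T * 8 + T * m := by rw [mul_comm P]; omega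
      _ = _ := by ring
  have hZ : 1 + 2 * V.size ≤ D * lg T := hD ▸ one_add_two_mul_size_le hV
  generalize 1 + 2 * V.size = Z at hZ ⊢
  refine ⟨?_, ?_, ?_, ?_⟩
  · calc c₀ * T + 8 * V + P * T * m + (P * T + 8)
        ≤ c₀ * T + 8 * (T * (P + 8 + m)) + P * T * m + (P * T + 8 * T) := by gcongr; omega
      _ = e₀ * T := by rw [he₀]; ring
      _ ≤ _ := Nat.mul_le_mul_right _ (by omega)
  · calc ((2 * m + 7) * (P * T) + 3) * Z
        ≤ ((2 * m + 7) * (P * T) + 3 * T) * (D * lg T) := by gcongr; omega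
      _ = e₁ * D * (T * lg T) := by rw [he₁]; ring
      _ ≤ _ := Nat.mul_le_mul_right _ (by omega)
  · calc (((2 * m + 7) * (P * T) + 4) * (P * T + 1) + 2) * Z
        ≤ (((2 * m + 7) * (P * T) + 4 * T) * (P * T + T) + 2 * T ^ 2) * (D * lg T) := by
          have : 1 ≤ T ^ 2 := Nat.one_le_pow _ _ hT
          gcongr <;> omega
      _ = e₂ * D * (T ^ 2 * lg T) := by rw [he₂]; ring
      _ ≤ _ := Nat.mul_le_mul_right _ (by omega)
  · calc (5 * (P * T) + k + 12) * Z + c₀ * (T * lg T)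
        ≤ (5 * (P * T) + k * T + 12 * T) * (D * lg T) + c₀ * (T * lg T) := by
          gcongr
          · exact Nat.le_mul_of_pos_right _ hT
          · omega
      _ = (e₃ * D + c₀) * (T * lg T) := by rw [he₃]; ring
      _ ≤ _ := Nat.mul_le_mul_right _ (by omega)

/-- The final register contents `R` of a machine of space `s₀` leave room for the streaming
machine. -/
theorem exists_spaceBound {s₀ N V m s : ℕ} {R : ℕ → ℕ} (hR : FitsIn s₀ R) (hV : N + 8 + m ≤ V)
    (hs : s₀ + 8 * V + N * m + (N + 8) ≤ s) :
    ∃ bnd, SpaceBound s N V m bnd ∧ Within bnd R := by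
  refine ⟨fun a => Nat.size (R a) + ((if a < 8 then V.size else 0) +
    if 8 ≤ a ∧ a < N + 8 then m.size else 0), ⟨fun a ha => ?_, ?_, fun a ha => ?_,
      fun i hi => ?_, hV⟩, fun a => Nat.le_add_right _ _⟩
  · have h1 : R a = 0 := hR.1 a (by omega)
    have h2 : ¬ a < 8 := by omega
    have h3 : ¬ a < N + 8 := by omega
    simp [h1, h2, h3]
  · rw [Finset.sum_add_distrib, Finset.sum_add_distrib]
    have e1 : ∑ a ∈ Finset.range s, Nat.size (R a) ≤ s₀ := by
      rw [hR.sum_size_eq (by omega)]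
      exact hR.2
    have e2 : ∑ a ∈ Finset.range s, (if a < 8 then V.size else 0) ≤ 8 * V := by
      rw [← Finset.sum_filter, Finset.sum_const, smul_eq_mul]
      refine Nat.mul_le_mul ?_ (Nat.size_le_self V)
      calc _ ≤ (Finset.range 8).card := Finset.card_le_card fun a => by simp
        _ = 8 := Finset.card_range 8
    have e3 : ∑ a ∈ Finset.range s, (if 8 ≤ a ∧ a < N + 8 then m.size else 0) ≤ N * m := by
      rw [← Finset.sum_filter, Finset.sum_const, smul_eq_mul]
      refine Nat.mul_le_mul ?_ (Nat.size_le_self m)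
      calc _ ≤ (Finset.Ico 8 (N + 8)).card := Finset.card_le_card fun a => by
            simp only [Finset.mem_filter, Finset.mem_Ico]; exact fun h => h.2
        _ = N := by simp
    omega
  · simp only [ha, if_true]; omega
  · have h1 : 8 ≤ i + 8 ∧ i + 8 < N + 8 := by omega
    simp only [h1, and_self, if_true]; omega

theorem theorem2 {α : Type} [Finite α] (t : ℕ → ℕ) (ht : ∀ n, 0 < n → 0 < t n)
    (hcomp : RAMComputable t t (fun n => t n * lg (t n)))
    (L : Language α) (hL : InSCA t L) :
    ∃ (M : RAM α) (c : ℕ),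
      M.Decides L ∧
      M.HasSpace (fun n => c * t n) ∧
      M.HasUpdateTime (fun n => c * (t n * lg (t n))) ∧
      M.HasReportingTime (fun n => c * (t n ^ 2 * lg (t n))) := by
  classical
  obtain ⟨S, rfl, k, hS⟩ := hL
  obtain ⟨M₀, c₀, hM⟩ := hcomp
  have := S.finite_Q
  obtain ⟨E⟩ := RankEnum.nonempty (Option (S.Q × S.Q))
  obtain ⟨c, hc⟩ := exists_resource_const c₀ k E.bound (2 ^ k)
  have key (w : List α) (hw : w ≠ []) : (S.streamRAM M₀ k E).Good w.length w (c * t w.length)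
      (fun i => if i < w.length then c * (t w.length * lg (t w.length))
        else c * (t w.length ^ 2 * lg (t w.length)))
      (if w ∈ S.language then 1 else 0) (S.streamRAM M₀ k E).initCfg
      (c * (t w.length * lg (t w.length))) := by
    have hn : 0 < w.length := List.length_pos_iff.2 hw
    obtain ⟨⟨j, hhalt, hout⟩, hfit, hops⟩ := hM _ hn
    obtain ⟨hspace, hupd, hrep, hinit⟩ := hc _ (ht _ hn)
    obtain ⟨bnd, hs, hR⟩ := exists_spaceBound (hfit j) le_rfl hspace
    -- `k * t |w|` steps of the automaton suffice, and `k < 2 ^ k`.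
    have hk : k * t w.length < 2 ^ k * t w.length :=
      Nat.mul_lt_mul_of_pos_right Nat.lt_two_pow_self (ht _ hn)
    refine (ShrinkingCA.good_initCfg hs hw (fun i => (hfit i).mono (by omega)) hhalt
      (by rw [hout]) hR ?_ (fun i hi => ?_) ?_).mono
        ((Nat.add_le_add_left (hops j) _).trans hinit)
    · simp only [hS.mem_language_iff w hw _ hk]
    · rw [if_pos hi]
      exact hupd
    · rw [if_neg (lt_irrefl _)]
      exact hrep
  refine ⟨S.streamRAM M₀ k E, c, fun w hw => ⟨fun h => ?_, fun h => ?_⟩,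
    fun w hw => (key w hw).fitsIn, fun w hw i hi j => ?_, fun w hw j => ?_⟩
  · have := (key w hw).halts
    rwa [if_pos h] at this
  · have := (key w hw).halts
    rwa [if_neg h] at this
  · refine ((key w hw).opsFrom_le i j).trans ?_
    change (if i < 0 then 0 else if i = 0 then _ else _) ≤ _
    rw [if_neg (Nat.not_lt_zero i), if_pos hi, ite_self]
  · refine ((key w hw).opsFrom_le w.length j).trans ?_
    change (if w.length < 0 then 0 else if w.length = 0 then _ else _) ≤ _
    rw [if_neg (Nat.not_lt_zero _), if_neg (by simpa using hw), if_neg (lt_irrefl _)]
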